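/- Let $(M,g)$ be an oriented smooth Riemannian manifold of dimension $2n+1$ $(n\ge 0)$ with Levi-Civita connection $\nabla^{lc}$. Let $\theta$ be a smooth $(1,1)$-tensor field on $M$ that is skew-symmetric, $g(\theta X,Y)=-g(X,\theta Y)$, has rank $2n$ at every point, and solves the gauge equation $\nabla^{lc}\theta=0$, i.e. $\nabla^{lc}_X(\theta Y)=\theta\,\nabla^{lc}_XY$ for all vector fields $X,Y$. Put $p_\theta(X,Y)=g(\theta X,Y)$ and $\ker p_\theta=\{X : p_\theta(X,\cdot)=0\}$. Then: 1. There is a smooth vector field $\xi_\theta$ on $M$ that is a section of $\ker p_\theta$ of unit length. 2. For every such $\xi_\theta$, put $\eta_\theta=g(\cdot,\xi_\theta)$. Then $(p_\theta,\eta_\theta)$ is a cosymplectic structure on $M$: $p_\theta$ is a closed $2$-form, $\eta_\theta$ is a closed $1$-form, and $\eta_\theta\wedge p_\theta^{\,n}$ vanishes nowhere. Its Reeb vector field (the vector field $\xi$ with $i_\xi p_\theta=0$ and $\eta_\theta(\xi)=1$) is $\xi_\theta$, and $\xi_\theta$ is a Killing vector field of $g$, i.e. $L_{\xi_\theta}g=0$.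 3. Consequently $M$ is K-cosymplectic, i.e. $M$ carries a cosymplectic structure whose Reeb vector field is Killing for some Riemannian metric on $M$. -/

import Mathlib

open Bundle FiberBundle VectorField
open scoped Manifold ContDiff Topology

section LC

variable {m : ℕ} {M : Type*} [TopologicalSpace M]
  [ChartedSpace (EuclideanSpace ℝ (Fin m)) M] [IsManifold (𝓡 m) ∞ M]

/-- The vector field `X` is differentiable at `x`, as a section of the tangent bundle. -/
abbrev FieldMDiffAt (X : Π x : M, TangentSpace (𝓡 m) x) (x : M) : Prop :=
  MDifferentiableAt (𝓡 m) ((𝓡 m).prod 𝓘(ℝ, EuclideanSpace ℝ (Fin m)))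
    (fun y ↦ TotalSpace.mk' (EuclideanSpace ℝ (Fin m)) y (X y)) x

/-- A smooth Riemannian metric on the `m`-manifold `M`. -/
abbrev RMetric (m : ℕ) (M : Type*) [TopologicalSpace M]
    [ChartedSpace (EuclideanSpace ℝ (Fin m)) M] [IsManifold (𝓡 m) ∞ M] :=
  ContMDiffRiemannianMetric (𝓡 m) ∞ (EuclideanSpace ℝ (Fin m))
    (fun x : M ↦ TangentSpace (𝓡 m) x)

theorem RMetric.mdifferentiableAt_inner (g : RMetric m M)
    {X Y : Π x : M, TangentSpace (𝓡 m) x} {x : M}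
    (hX : FieldMDiffAt X x) (hY : FieldMDiffAt Y x) :
    MDifferentiableAt (𝓡 m) 𝓘(ℝ, ℝ) (fun y ↦ g.inner y (X y) (Y y)) x := by
  let : RiemannianBundle (fun x : M ↦ TangentSpace (𝓡 m) x) := ⟨g.toRiemannianMetric⟩
  exact MDifferentiableAt.inner_bundle hX hY

/-- The right-hand side of the Koszul formula, which determines `g(∇_X Y, Z)` at `x`. -/
noncomputable def RMetric.koszul (g : RMetric m M)
    (X Y Z : Π x : M, TangentSpace (𝓡 m) x) (x : M) : ℝ :=
  (1 / 2) *
    (mvfderiv (𝓡 m) (fun y ↦ g.inner y (Y y) (Z y)) x (X x)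
      + mvfderiv (𝓡 m) (fun y ↦ g.inner y (X y) (Z y)) x (Y x)
      - mvfderiv (𝓡 m) (fun y ↦ g.inner y (X y) (Y y)) x (Z x)
      + g.inner x (mlieBracket (𝓡 m) X Y x) (Z x)
      - g.inner x (mlieBracket (𝓡 m) X Z x) (Y x)
      - g.inner x (mlieBracket (𝓡 m) Y Z x) (X x))

theorem RMetric.koszul_tensorial_right (g : RMetric m M)
    {X Y : Π x : M, TangentSpace (𝓡 m) x} {x : M}
    (hX : FieldMDiffAt X x) (hY : FieldMDiffAt Y x) :
    TensorialAt (𝓡 m) (EuclideanSpace ℝ (Fin m)) (fun Z ↦ g.koszul X Y Z x) x where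
  smul {f Z} hf hZ := by
    have h1 := mvfderiv_fun_mul hf (g.mdifferentiableAt_inner hY hZ)
    have h2 := mvfderiv_fun_mul hf (g.mdifferentiableAt_inner hX hZ)
    simp [RMetric.koszul, h1, h2, mlieBracket_smul_right hf hZ, g.symm x (Z x)]
    ring
  add {Z Z'} hZ hZ' := by
    have h1 := mvfderiv_fun_add (g.mdifferentiableAt_inner hY hZ) (g.mdifferentiableAt_inner hY hZ')
    have h2 := mvfderiv_fun_add (g.mdifferentiableAt_inner hX hZ) (g.mdifferentiableAt_inner hX hZ')
    simp [RMetric.koszul, h1, h2, mlieBracket_add_right hZ hZ']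
    ring

theorem RMetric.koszul_tensorial_left (g : RMetric m M)
    {Y Z : Π x : M, TangentSpace (𝓡 m) x} {x : M}
    (hY : FieldMDiffAt Y x) (hZ : FieldMDiffAt Z x) :
    TensorialAt (𝓡 m) (EuclideanSpace ℝ (Fin m)) (fun X ↦ g.koszul X Y Z x) x where
  smul {f X} hf hX := by
    have h1 := mvfderiv_fun_mul hf (g.mdifferentiableAt_inner hX hZ)
    have h2 := mvfderiv_fun_mul hf (g.mdifferentiableAt_inner hX hY)
    simp [RMetric.koszul, h1, h2, mlieBracket_smul_left hf hX]
    ring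
  add {X X'} hX hX' := by
    have h1 := mvfderiv_fun_add (g.mdifferentiableAt_inner hX hZ) (g.mdifferentiableAt_inner hX' hZ)
    have h2 := mvfderiv_fun_add (g.mdifferentiableAt_inner hX hY) (g.mdifferentiableAt_inner hX' hY)
    simp [RMetric.koszul, h1, h2, mlieBracket_add_left hX hX']
    ring

theorem RMetric.koszul_add_mid (g : RMetric m M)
    {X Y Y' Z : Π x : M, TangentSpace (𝓡 m) x} {x : M} (hX : FieldMDiffAt X x)
    (hY : FieldMDiffAt Y x) (hY' : FieldMDiffAt Y' x) (hZ : FieldMDiffAt Z x) :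
    g.koszul X (Y + Y') Z x = g.koszul X Y Z x + g.koszul X Y' Z x := by
  have h1 := mvfderiv_fun_add (g.mdifferentiableAt_inner hY hZ) (g.mdifferentiableAt_inner hY' hZ)
  have h2 := mvfderiv_fun_add (g.mdifferentiableAt_inner hX hY) (g.mdifferentiableAt_inner hX hY')
  simp [RMetric.koszul, h1, h2, mlieBracket_add_left hY hY', mlieBracket_add_right hY hY']
  ring

theorem RMetric.koszul_leibniz (g : RMetric m M)
    {X Y Z : Π x : M, TangentSpace (𝓡 m) x} {f : M → ℝ} {x : M} (hX : FieldMDiffAt X x)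
    (hY : FieldMDiffAt Y x) (hf : MDifferentiableAt (𝓡 m) 𝓘(ℝ, ℝ) f x) (hZ : FieldMDiffAt Z x) :
    g.koszul X (f • Y) Z x
      = f x * g.koszul X Y Z x + mvfderiv (𝓡 m) f x (X x) * g.inner x (Y x) (Z x) := by
  have h1 := mvfderiv_fun_mul hf (g.mdifferentiableAt_inner hY hZ)
  have h2 := mvfderiv_fun_mul hf (g.mdifferentiableAt_inner hX hY)
  simp [RMetric.koszul, h1, h2, mlieBracket_smul_left hf hY, mlieBracket_smul_right hf hY,
    g.symm x (Y x) (X x)]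
  ring

/-- The musical isomorphism `v ↦ g(v, ·)`. -/
noncomputable def RMetric.flatEquiv (g : RMetric m M) (x : M) :
    TangentSpace (𝓡 m) x ≃ₗ[ℝ] (TangentSpace (𝓡 m) x →L[ℝ] ℝ) :=
  haveI : FiniteDimensional ℝ (TangentSpace (𝓡 m) x) :=
    inferInstanceAs (FiniteDimensional ℝ (EuclideanSpace ℝ (Fin m)))
  haveI : T2Space (TangentSpace (𝓡 m) x) :=
    inferInstanceAs (T2Space (EuclideanSpace ℝ (Fin m)))
  LinearEquiv.ofInjectiveOfFinrankEq (g.inner x).toLinearMap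
    (by
      rw [← LinearMap.ker_eq_bot, LinearMap.ker_eq_bot']
      intro v hv
      by_contra h
      have h1 := g.pos x v h
      have h2 : g.inner x v = 0 := hv
      simp [h2] at h1)
    (Subspace.dual_finrank_eq.symm.trans (LinearMap.toContinuousLinearMap :
      (TangentSpace (𝓡 m) x →ₗ[ℝ] ℝ) ≃ₗ[ℝ] (TangentSpace (𝓡 m) x →L[ℝ] ℝ)).finrank_eq)

theorem RMetric.inner_flatEquiv_symm (g : RMetric m M) (x : M)
    (α : TangentSpace (𝓡 m) x →L[ℝ] ℝ) (w : TangentSpace (𝓡 m) x) :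
    g.inner x ((g.flatEquiv x).symm α) w = α w := by
  have h := (g.flatEquiv x).apply_symm_apply α
  exact congrArg (fun β : TangentSpace (𝓡 m) x →L[ℝ] ℝ ↦ β w) h

theorem RMetric.ext_inner (g : RMetric m M) {x : M} {v w : TangentSpace (𝓡 m) x}
    (h : ∀ u, g.inner x v u = g.inner x w u) : v = w :=
  (g.flatEquiv x).injective (ContinuousLinearMap.ext h)

open Classical in
/-- The value at `x` of the Levi-Civita derivative of `Y`, given by the Koszul formula
(and `0` if `Y` is not differentiable at `x`). -/
noncomputable def RMetric.lcDeriv (g : RMetric m M)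
    (Y : Π x : M, TangentSpace (𝓡 m) x) (x : M) :
    TangentSpace (𝓡 m) x →L[ℝ] TangentSpace (𝓡 m) x :=
  if hY : FieldMDiffAt Y x then
    haveI : FiniteDimensional ℝ (TangentSpace (𝓡 m) x) :=
      inferInstanceAs (FiniteDimensional ℝ (EuclideanSpace ℝ (Fin m)))
    haveI : T2Space (TangentSpace (𝓡 m) x) :=
      inferInstanceAs (T2Space (EuclideanSpace ℝ (Fin m)))
    LinearMap.toContinuousLinearMap
      ((g.flatEquiv x).symm.toLinearMap ∘ₗ
        (TensorialAt.mkHom₂ (I := 𝓡 m) (F := EuclideanSpace ℝ (Fin m))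
          (F' := EuclideanSpace ℝ (Fin m)) (fun X Z ↦ g.koszul X Y Z x) x
          (fun _ hZ ↦ g.koszul_tensorial_left hY hZ)
          (fun _ hX ↦ g.koszul_tensorial_right hX hY)).toLinearMap)
  else 0

theorem RMetric.inner_lcDeriv (g : RMetric m M)
    {X Y Z : Π x : M, TangentSpace (𝓡 m) x} {x : M} (hX : FieldMDiffAt X x)
    (hY : FieldMDiffAt Y x) (hZ : FieldMDiffAt Z x) :
    g.inner x (g.lcDeriv Y x (X x)) (Z x) = g.koszul X Y Z x := by
  rw [RMetric.lcDeriv, dif_pos hY]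
  refine (g.inner_flatEquiv_symm x _ (Z x)).trans ?_
  exact TensorialAt.mkHom₂_apply (I := 𝓡 m) (F := EuclideanSpace ℝ (Fin m))
    (F' := EuclideanSpace ℝ (Fin m)) (Φ := fun X Z ↦ g.koszul X Y Z x)
    (fun _ hZ ↦ g.koszul_tensorial_left hY hZ)
    (fun _ hX ↦ g.koszul_tensorial_right hX hY) hX hZ

theorem RMetric.lcDeriv_ext (g : RMetric m M) {x : M}
    {A B : TangentSpace (𝓡 m) x →L[ℝ] TangentSpace (𝓡 m) x}
    (h : ∀ X Z : Π x : M, TangentSpace (𝓡 m) x, FieldMDiffAt X x → FieldMDiffAt Z x →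
      g.inner x (A (X x)) (Z x) = g.inner x (B (X x)) (Z x)) : A = B := by
  refine ContinuousLinearMap.ext fun v ↦ g.ext_inner fun u ↦ ?_
  have := h (extend (EuclideanSpace ℝ (Fin m)) v) (extend (EuclideanSpace ℝ (Fin m)) u)
    (mdifferentiableAt_extend ..) (mdifferentiableAt_extend ..)
  simpa using this

/-- The Levi-Civita connection of `g`. -/
noncomputable def RMetric.leviCivita (g : RMetric m M) :
    CovariantDerivative (𝓡 m) (EuclideanSpace ℝ (Fin m))
      (fun x : M ↦ TangentSpace (𝓡 m) x) where
  toFun := g.lcDeriv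
  isCovariantDerivativeOnUniv :=
    { add := fun {Y Y' x} hY hY' _ ↦ g.lcDeriv_ext fun X Z hX hZ ↦ by
        rw [g.inner_lcDeriv hX (mdifferentiableAt_add_section hY hY') hZ,
          g.koszul_add_mid hX hY hY' hZ]
        simp [g.inner_lcDeriv hX hY hZ, g.inner_lcDeriv hX hY' hZ]
      leibniz := fun {Y f x} hY hf _ ↦ g.lcDeriv_ext fun X Z hX hZ ↦ by
        rw [g.inner_lcDeriv hX (hf.smul_section hY) hZ, g.koszul_leibniz hX hY hf hZ]
        simp [g.inner_lcDeriv hX hY hZ] }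

theorem RMetric.leviCivita_torsion (g : RMetric m M) : g.leviCivita.torsion = 0 := by
  rw [CovariantDerivative.torsion_eq_zero_iff]
  intro X Y x hX hY
  refine g.ext_inner fun u ↦ ?_
  have hZ : FieldMDiffAt (extend (EuclideanSpace ℝ (Fin m)) u) x := mdifferentiableAt_extend ..
  have h1 := g.inner_lcDeriv hX hY hZ
  have h2 := g.inner_lcDeriv hY hX hZ
  have h3 : g.koszul X Y (extend (EuclideanSpace ℝ (Fin m)) u) x
      - g.koszul Y X (extend (EuclideanSpace ℝ (Fin m)) u) x
      = g.inner x (mlieBracket (𝓡 m) X Y x) u := by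
    have h4 : (fun y ↦ g.inner y (X y) (Y y)) = fun y ↦ g.inner y (Y y) (X y) :=
      funext fun y ↦ g.symm y _ _
    simp only [RMetric.koszul, h4, extend_apply_self]
    rw [mlieBracket_swap_apply (V := Y) (W := X)]
    simp
    ring
  simp only [extend_apply_self] at h1 h2
  rw [← h3, ← h1, ← h2, map_sub]
  rfl

theorem RMetric.leviCivita_metric (g : RMetric m M)
    {X Y Z : Π x : M, TangentSpace (𝓡 m) x} {x : M} (hX : FieldMDiffAt X x)
    (hY : FieldMDiffAt Y x) (hZ : FieldMDiffAt Z x) :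
    mvfderiv (𝓡 m) (fun y ↦ g.inner y (Y y) (Z y)) x (X x)
      = g.inner x (g.leviCivita Y x (X x)) (Z x) + g.inner x (Y x) (g.leviCivita Z x (X x)) := by
  have h1 : g.inner x (g.leviCivita Y x (X x)) (Z x) = _ := g.inner_lcDeriv hX hY hZ
  have h2 : g.inner x (g.leviCivita Z x (X x)) (Y x) = _ := g.inner_lcDeriv hX hZ hY
  have h4 : (fun y ↦ g.inner y (Z y) (Y y)) = fun y ↦ g.inner y (Y y) (Z y) :=
    funext fun y ↦ g.symm y _ _
  rw [g.symm x (Y x), h1, h2]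
  simp only [RMetric.koszul, h4]
  rw [mlieBracket_swap_apply (V := Z) (W := Y)]
  simp
  ring

end LC

section Tensors

variable {m : ℕ} {M : Type*} [TopologicalSpace M]
  [ChartedSpace (EuclideanSpace ℝ (Fin m)) M] [IsManifold (𝓡 m) ∞ M]

/-- `X` is a smooth vector field. -/
def IsSmoothField (X : Π x : M, TangentSpace (𝓡 m) x) : Prop :=
  ContMDiff (𝓡 m) ((𝓡 m).prod 𝓘(ℝ, EuclideanSpace ℝ (Fin m))) ∞
    (fun x ↦ TotalSpace.mk' (EuclideanSpace ℝ (Fin m)) x (X x))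

/-- `θ` is a smooth `(1,1)`-tensor field. -/
def IsSmoothEndo (θ : Π x : M, TangentSpace (𝓡 m) x →L[ℝ] TangentSpace (𝓡 m) x) : Prop :=
  ContMDiff (𝓡 m)
    ((𝓡 m).prod 𝓘(ℝ, EuclideanSpace ℝ (Fin m) →L[ℝ] EuclideanSpace ℝ (Fin m))) ∞
    (fun x ↦ TotalSpace.mk' (EuclideanSpace ℝ (Fin m) →L[ℝ] EuclideanSpace ℝ (Fin m)) x (θ x))

/-- `η` is a smooth differential `1`-form. -/
def IsSmoothOneForm (η : Π x : M, TangentSpace (𝓡 m) x →L[ℝ] ℝ) : Prop :=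
  ContMDiff (𝓡 m) ((𝓡 m).prod 𝓘(ℝ, EuclideanSpace ℝ (Fin m) →L[ℝ] ℝ)) ∞
    (fun x ↦ TotalSpace.mk' (EuclideanSpace ℝ (Fin m) →L[ℝ] ℝ) x (η x))

/-- `Ω` is a smooth differential `2`-form: a smooth alternating `(0,2)`-tensor field. -/
structure IsSmoothTwoForm
    (Ω : Π x : M, TangentSpace (𝓡 m) x →L[ℝ] TangentSpace (𝓡 m) x →L[ℝ] ℝ) : Prop where
  smooth : ContMDiff (𝓡 m)
    ((𝓡 m).prod 𝓘(ℝ, EuclideanSpace ℝ (Fin m) →L[ℝ] EuclideanSpace ℝ (Fin m) →L[ℝ] ℝ)) ∞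
    (fun x ↦ TotalSpace.mk'
      (EuclideanSpace ℝ (Fin m) →L[ℝ] EuclideanSpace ℝ (Fin m) →L[ℝ] ℝ) x (Ω x))
  alternating : ∀ x v, Ω x v v = 0

/-- `dη(X, Y) = X(η(Y)) - Y(η(X)) - η([X, Y])`, at the point `x`. -/
noncomputable def extDerivOneForm (η : Π x : M, TangentSpace (𝓡 m) x →L[ℝ] ℝ)
    (X Y : Π x : M, TangentSpace (𝓡 m) x) (x : M) : ℝ :=
  mvfderiv (𝓡 m) (fun y ↦ η y (Y y)) x (X x)
    - mvfderiv (𝓡 m) (fun y ↦ η y (X y)) x (Y x)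
    - η x (mlieBracket (𝓡 m) X Y x)

/-- `dΩ(X, Y, Z) = X(Ω(Y, Z)) - Y(Ω(X, Z)) + Z(Ω(X, Y)) - Ω([X, Y], Z) + Ω([X, Z], Y)
- Ω([Y, Z], X)`, at the point `x`. -/
noncomputable def extDerivTwoForm
    (Ω : Π x : M, TangentSpace (𝓡 m) x →L[ℝ] TangentSpace (𝓡 m) x →L[ℝ] ℝ)
    (X Y Z : Π x : M, TangentSpace (𝓡 m) x) (x : M) : ℝ :=
  mvfderiv (𝓡 m) (fun y ↦ Ω y (Y y) (Z y)) x (X x)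
    - mvfderiv (𝓡 m) (fun y ↦ Ω y (X y) (Z y)) x (Y x)
    + mvfderiv (𝓡 m) (fun y ↦ Ω y (X y) (Y y)) x (Z x)
    - Ω x (mlieBracket (𝓡 m) X Y x) (Z x)
    + Ω x (mlieBracket (𝓡 m) X Z x) (Y x)
    - Ω x (mlieBracket (𝓡 m) Y Z x) (X x)

/-- The `1`-form `η` is closed. -/
def IsClosedOneForm (η : Π x : M, TangentSpace (𝓡 m) x →L[ℝ] ℝ) : Prop :=
  ∀ X Y : Π x : M, TangentSpace (𝓡 m) x, IsSmoothField X → IsSmoothField Y →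
    ∀ x, extDerivOneForm η X Y x = 0

/-- The `2`-form `Ω` is closed. -/
def IsClosedTwoForm
    (Ω : Π x : M, TangentSpace (𝓡 m) x →L[ℝ] TangentSpace (𝓡 m) x →L[ℝ] ℝ) : Prop :=
  ∀ X Y Z : Π x : M, TangentSpace (𝓡 m) x,
    IsSmoothField X → IsSmoothField Y → IsSmoothField Z → ∀ x, extDerivTwoForm Ω X Y Z x = 0

/-- `(∇_v θ)(Y) = ∇_v (θ Y) - θ (∇_v Y)` for `v` a tangent vector at `x`. -/
noncomputable def covDerivEndo
    (D : CovariantDerivative (𝓡 m) (EuclideanSpace ℝ (Fin m))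
      (fun x : M ↦ TangentSpace (𝓡 m) x))
    (θ : Π x : M, TangentSpace (𝓡 m) x →L[ℝ] TangentSpace (𝓡 m) x)
    (Y : Π x : M, TangentSpace (𝓡 m) x) (x : M) (v : TangentSpace (𝓡 m) x) :
    TangentSpace (𝓡 m) x :=
  D (fun y ↦ θ y (Y y)) x v - θ x (D Y x v)

/-- `∇θ = 0`. -/
def IsParallelEndo
    (D : CovariantDerivative (𝓡 m) (EuclideanSpace ℝ (Fin m))
      (fun x : M ↦ TangentSpace (𝓡 m) x))
    (θ : Π x : M, TangentSpace (𝓡 m) x →L[ℝ] TangentSpace (𝓡 m) x) : Prop :=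
  ∀ Y : Π x : M, TangentSpace (𝓡 m) x, IsSmoothField Y → ∀ x v, covDerivEndo D θ Y x v = 0

/-- The tensor `p_θ(X, Y) = g(θ X, Y)`. -/
noncomputable def RMetric.form (g : RMetric m M)
    (θ : Π x : M, TangentSpace (𝓡 m) x →L[ℝ] TangentSpace (𝓡 m) x) (x : M) :
    TangentSpace (𝓡 m) x →L[ℝ] TangentSpace (𝓡 m) x →L[ℝ] ℝ :=
  (g.inner x).comp (θ x)

/-- The `1`-form `ξ♭ = g(ξ, ·)` dual to the vector field `ξ`. -/
noncomputable def RMetric.flat (g : RMetric m M) (ξ : Π x : M, TangentSpace (𝓡 m) x) (x : M) :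
    TangentSpace (𝓡 m) x →L[ℝ] ℝ :=
  g.inner x (ξ x)

/-- `(L_ξ g)(X, Y) = ξ(g(X, Y)) - g([ξ, X], Y) - g(X, [ξ, Y])`, at the point `x`. -/
noncomputable def RMetric.lieDeriv (g : RMetric m M)
    (ξ X Y : Π x : M, TangentSpace (𝓡 m) x) (x : M) : ℝ :=
  mvfderiv (𝓡 m) (fun y ↦ g.inner y (X y) (Y y)) x (ξ x)
    - g.inner x (mlieBracket (𝓡 m) ξ X x) (Y x)
    - g.inner x (X x) (mlieBracket (𝓡 m) ξ Y x)

/-- `ξ` is a Killing vector field of `g`: it is smooth and `L_ξ g = 0`. -/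
def RMetric.IsKilling (g : RMetric m M) (ξ : Π x : M, TangentSpace (𝓡 m) x) : Prop :=
  IsSmoothField ξ ∧ ∀ X Y : Π x : M, TangentSpace (𝓡 m) x,
    IsSmoothField X → IsSmoothField Y → ∀ x, g.lieDeriv ξ X Y x = 0

/-- `A` is an oriented smooth atlas of `M`: its charts are smooth, cover `M`, and all changes of
coordinates between them have positive Jacobian determinant. -/
structure IsOrientedAtlas
    (A : Set (OpenPartialHomeomorph M (EuclideanSpace ℝ (Fin m)))) : Prop where
  subset_maximalAtlas : A ⊆ IsManifold.maximalAtlas (𝓡 m) ∞ M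
  covers : ∀ x : M, ∃ φ ∈ A, x ∈ φ.source
  det_pos : ∀ φ ∈ A, ∀ ψ ∈ A, ∀ x ∈ φ.source ∩ ψ.source,
    0 < (fderiv ℝ (ψ ∘ φ.symm) (φ x)).det

end Tensors

/-- The value of the `(2n+1)`-form `η ∧ Ω^n` on the vectors `v 0, …, v (2n)`, for a linear form `η`
and an alternating bilinear form `Ω`:
`2^{-n} ∑_σ sgn(σ) η(v_{σ(0)}) Ω(v_{σ(1)}, v_{σ(2)}) ⋯ Ω(v_{σ(2n-1)}, v_{σ(2n)})`. -/
noncomputable def wedgePow (n : ℕ) {V : Type*} (η : V → ℝ) (Ω : V → V → ℝ)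
    (v : Fin (2 * n + 1) → V) : ℝ :=
  (1 / 2 ^ n : ℝ) * ∑ σ : Equiv.Perm (Fin (2 * n + 1)),
    ((Equiv.Perm.sign σ : ℤ) : ℝ) * (η (v (σ 0)) *
      ∏ i : Fin n, Ω (v (σ ⟨2 * i + 1, by omega⟩)) (v (σ ⟨2 * i + 2, by omega⟩)))

section Cosymplectic

variable {n : ℕ} {M : Type*} [TopologicalSpace M]
  [ChartedSpace (EuclideanSpace ℝ (Fin (2 * n + 1))) M] [IsManifold (𝓡 (2 * n + 1)) ∞ M]

/-- `(Ω, η)` is a cosymplectic structure on the `(2n+1)`-manifold `M`: `Ω` is a closed `2`-form, `η`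
a closed `1`-form, and `η ∧ Ω^n` is a volume form (vanishes at no point). -/
structure IsCosymplectic
    (Ω : Π x : M, TangentSpace (𝓡 (2 * n + 1)) x →L[ℝ] TangentSpace (𝓡 (2 * n + 1)) x →L[ℝ] ℝ)
    (η : Π x : M, TangentSpace (𝓡 (2 * n + 1)) x →L[ℝ] ℝ) : Prop where
  smooth_two : IsSmoothTwoForm Ω
  smooth_one : IsSmoothOneForm η
  closed_two : IsClosedTwoForm Ω
  closed_one : IsClosedOneForm η
  volume : ∀ x, ∃ v : Fin (2 * n + 1) → TangentSpace (𝓡 (2 * n + 1)) x,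
    wedgePow n (fun u ↦ η x u) (fun u w ↦ Ω x u w) v ≠ 0

/-- `ξ` is the Reeb vector field of `(Ω, η)`: `i_ξ Ω = 0` and `η(ξ) = 1`. -/
structure IsReebField
    (Ω : Π x : M, TangentSpace (𝓡 (2 * n + 1)) x →L[ℝ] TangentSpace (𝓡 (2 * n + 1)) x →L[ℝ] ℝ)
    (η : Π x : M, TangentSpace (𝓡 (2 * n + 1)) x →L[ℝ] ℝ)
    (ξ : Π x : M, TangentSpace (𝓡 (2 * n + 1)) x) : Prop where
  smooth : IsSmoothField ξ
  contract_two : ∀ x, Ω x (ξ x) = 0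
  contract_one : ∀ x, η x (ξ x) = 1

/-- `ξ` is a smooth section of `ker p_θ` of unit length, where `p_θ = g(θ ·, ·)`. -/
structure IsUnitKernelField (g : RMetric (2 * n + 1) M)
    (θ : Π x : M, TangentSpace (𝓡 (2 * n + 1)) x →L[ℝ] TangentSpace (𝓡 (2 * n + 1)) x)
    (ξ : Π x : M, TangentSpace (𝓡 (2 * n + 1)) x) : Prop where
  smooth : IsSmoothField ξ
  mem_ker : ∀ x, g.form θ x (ξ x) = 0
  unit : ∀ x, g.inner x (ξ x) (ξ x) = 1

variable (n M) in
/-- `M` is K-cosymplectic: it carries a cosymplectic structure whose Reeb vector field is Killing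
for some Riemannian metric on `M`. -/
def IsKCosymplectic : Prop :=
  ∃ (Ω : Π x : M, TangentSpace (𝓡 (2 * n + 1)) x →L[ℝ] TangentSpace (𝓡 (2 * n + 1)) x →L[ℝ] ℝ)
    (η : Π x : M, TangentSpace (𝓡 (2 * n + 1)) x →L[ℝ] ℝ),
    IsCosymplectic Ω η ∧ ∃ ξ : Π x : M, TangentSpace (𝓡 (2 * n + 1)) x, IsReebField Ω η ξ ∧
      ∃ h : RMetric (2 * n + 1) M, h.IsKilling ξ

end Cosymplectic

/-! ### Consequences of parallelism: closed forms, Killing fields, smoothness. -/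

section Parallel

variable {m : ℕ} {M : Type*} [TopologicalSpace M]
  [ChartedSpace (EuclideanSpace ℝ (Fin m)) M] [IsManifold (𝓡 m) ∞ M]

/-! Everything except the existence of `ξ` follows from parallelism. The connection is metric and
torsion-free, so the exterior derivative of a form is the alternation of its covariant derivative,
and `p_θ` is closed because `θ` is parallel. If `ξ` is a unit section of `ker θ`, then `θ(∇ξ) =
∇(θξ) = 0` puts `∇ξ` in the line `ℝξ`, while `g(ξ, ξ) = 1` makes it orthogonal to `ξ`; hence `∇ξ =
0` (`IsUnitKernelField.leviCivita_eq_zero`). A parallel field is Killing and its dual form is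
closed.

That `η ∧ p_θ^n` has no zero is linear algebra: a symplectic basis of a complement of `ℝξ` makes
every term of the permutation sum nonnegative and the identity term positive
(`wedgePowAlternating_ne_zero`).

The existence of `ξ` uses the orientation. The line `ker θ` has two unit vectors at each point, and
the sign of `v♭ ∧ p_θ^n` on oriented coordinate frames selects one of them. The choice is smooth
because `ker θ` has smooth local unit sections (`exists_local_unit_kernel_field`) and the sign is
locally constant along them (`exists_isUnitKernelField`). -/

theorem IsSmoothField.fieldMDiffAt {X : Π x : M, TangentSpace (𝓡 m) x} (hX : IsSmoothField X)
    (x : M) : FieldMDiffAt X x :=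
  (hX x).mdifferentiableAt (by simp)

theorem IsSmoothEndo.apply {θ : Π x : M, TangentSpace (𝓡 m) x →L[ℝ] TangentSpace (𝓡 m) x}
    (hθ : IsSmoothEndo θ) {X : Π x : M, TangentSpace (𝓡 m) x} (hX : IsSmoothField X) :
    IsSmoothField fun x ↦ θ x (X x) :=
  ContMDiff.clm_bundle_apply (b := fun x : M ↦ x) (E₁ := fun x : M ↦ TangentSpace (𝓡 m) x)
    (E₂ := fun x : M ↦ TangentSpace (𝓡 m) x) hθ hX

theorem RMetric.mlieBracket_eq (g : RMetric m M) {X Y : Π x : M, TangentSpace (𝓡 m) x} {x : M}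
    (hX : FieldMDiffAt X x) (hY : FieldMDiffAt Y x) :
    mlieBracket (𝓡 m) X Y x = g.leviCivita Y x (X x) - g.leviCivita X x (Y x) :=
  (g.leviCivita.torsion_eq_zero_iff.1 g.leviCivita_torsion hX hY).symm

theorem IsParallelEndo.leviCivita_apply {g : RMetric m M}
    {θ : Π x : M, TangentSpace (𝓡 m) x →L[ℝ] TangentSpace (𝓡 m) x}
    (h : IsParallelEndo g.leviCivita θ) {Y : Π x : M, TangentSpace (𝓡 m) x}
    (hY : IsSmoothField Y) (x : M) (v : TangentSpace (𝓡 m) x) :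
    g.leviCivita (fun y ↦ θ y (Y y)) x v = θ x (g.leviCivita Y x v) :=
  sub_eq_zero.1 (h Y hY x v)

/-- Metric compatibility and `∇θ = 0` give a Leibniz rule for `p_θ`. Once the brackets are written
as `∇_X Y - ∇_Y X`, the terms of `dp_θ` cancel by antisymmetry. -/
theorem IsParallelEndo.isClosedTwoForm {g : RMetric m M}
    {θ : Π x : M, TangentSpace (𝓡 m) x →L[ℝ] TangentSpace (𝓡 m) x} (hs : IsSmoothEndo θ)
    (hskew : ∀ x u v, g.inner x (θ x u) v = -g.inner x u (θ x v))
    (h : IsParallelEndo g.leviCivita θ) : IsClosedTwoForm (g.form θ) := by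
  intro X Y Z hX hY hZ x
  have key : ∀ {U V W : Π x : M, TangentSpace (𝓡 m) x}, IsSmoothField U → IsSmoothField V →
      IsSmoothField W → mvfderiv (𝓡 m) (fun y ↦ g.form θ y (V y) (W y)) x (U x)
        = g.form θ x (g.leviCivita V x (U x)) (W x)
          + g.form θ x (V x) (g.leviCivita W x (U x)) := by
    intro U V W hU hV hW
    have := g.leviCivita_metric (hU.fieldMDiffAt x) ((hs.apply hV).fieldMDiffAt x)
      (hW.fieldMDiffAt x)
    rw [h.leviCivita_apply hV] at this
    exact this
  have alt : ∀ u v, g.form θ x u v = -g.form θ x v u := fun u v ↦ by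
    change g.inner x (θ x u) v = -g.inner x (θ x v) u
    rw [hskew, g.symm]
  rw [extDerivTwoForm, key hX hY hZ, key hY hX hZ, key hZ hX hY,
    g.mlieBracket_eq (hX.fieldMDiffAt x) (hY.fieldMDiffAt x),
    g.mlieBracket_eq (hX.fieldMDiffAt x) (hZ.fieldMDiffAt x),
    g.mlieBracket_eq (hY.fieldMDiffAt x) (hZ.fieldMDiffAt x)]
  simp only [map_sub, sub_apply]
  rw [alt (Y x) (g.leviCivita Z x (X x)), alt (X x) (g.leviCivita Z x (Y x)),
    alt (X x) (g.leviCivita Y x (Z x))]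
  ring

/-- A parallel field is Killing. -/
theorem RMetric.isKilling_of_parallel (g : RMetric m M) {ξ : Π x : M, TangentSpace (𝓡 m) x}
    (hξ : IsSmoothField ξ) (h : ∀ x, g.leviCivita ξ x = 0) : g.IsKilling ξ := by
  refine ⟨hξ, fun X Y hX hY x ↦ ?_⟩
  rw [RMetric.lieDeriv, g.leviCivita_metric (hξ.fieldMDiffAt x) (hX.fieldMDiffAt x)
    (hY.fieldMDiffAt x), g.mlieBracket_eq (hξ.fieldMDiffAt x) (hX.fieldMDiffAt x),
    g.mlieBracket_eq (hξ.fieldMDiffAt x) (hY.fieldMDiffAt x), h]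
  simp

/-- The dual form of a parallel field is closed. -/
theorem RMetric.isClosedOneForm_flat_of_parallel (g : RMetric m M)
    {ξ : Π x : M, TangentSpace (𝓡 m) x} (hξ : IsSmoothField ξ) (h : ∀ x, g.leviCivita ξ x = 0) :
    IsClosedOneForm (g.flat ξ) := by
  intro X Y hX hY x
  have h1 := g.leviCivita_metric (hX.fieldMDiffAt x) (hξ.fieldMDiffAt x) (hY.fieldMDiffAt x)
  have h2 := g.leviCivita_metric (hY.fieldMDiffAt x) (hξ.fieldMDiffAt x) (hX.fieldMDiffAt x)
  rw [extDerivOneForm, g.mlieBracket_eq (hX.fieldMDiffAt x) (hY.fieldMDiffAt x)]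
  simp only [RMetric.flat]
  rw [h1, h2, h]
  simp

theorem IsSmoothEndo.smooth_form (g : RMetric m M)
    {θ : Π x : M, TangentSpace (𝓡 m) x →L[ℝ] TangentSpace (𝓡 m) x} (hθ : IsSmoothEndo θ)
    (hskew : ∀ x u v, g.inner x (θ x u) v = -g.inner x u (θ x v)) : IsSmoothTwoForm (g.form θ) where
  alternating x v := by
    have h1 : g.form θ x v v = -g.inner x v (θ x v) := hskew x v v
    have h2 : g.form θ x v v = g.inner x v (θ x v) := g.symm x _ _
    linarith
  smooth := by
    intro x₀
    have hg := (contMDiffAt_hom_bundle _).1 (g.contMDiff x₀)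
    have ht := (contMDiffAt_hom_bundle _).1 (hθ x₀)
    refine (contMDiffAt_hom_bundle _).2 ⟨contMDiffAt_id, ?_⟩
    refine (hg.2.clm_comp ht.2).congr_of_eventuallyEq ?_
    filter_upwards [(trivializationAt (EuclideanSpace ℝ (Fin m))
      (fun x : M ↦ TangentSpace (𝓡 m) x) x₀).open_baseSet.mem_nhds
        (mem_baseSet_trivializationAt _ _ x₀)] with x hx
    -- On the base set, the trivialization ending the coordinate expression of `θ` cancels the
    -- inverse one starting that of `g`.
    refine ContinuousLinearMap.ext fun u ↦ ?_
    simp only [ContinuousLinearMap.inCoordinates, ContinuousLinearMap.comp_apply]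
    rw [Trivialization.symmL_continuousLinearMapAt _ hx]
    rfl

theorem IsSmoothField.smooth_flat (g : RMetric m M) {ξ : Π x : M, TangentSpace (𝓡 m) x}
    (hξ : IsSmoothField ξ) : IsSmoothOneForm (g.flat ξ) :=
  ContMDiff.clm_bundle_apply (b := fun x : M ↦ x) (E₁ := fun x : M ↦ TangentSpace (𝓡 m) x)
    (E₂ := fun x : M ↦ TangentSpace (𝓡 m) x →L[ℝ] ℝ) g.contMDiff hξ

end Parallel

theorem finrank_ker_of_finrank_range {n : ℕ} {M : Type*} [TopologicalSpace M]
    [ChartedSpace (EuclideanSpace ℝ (Fin (2 * n + 1))) M] {x : M}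
    {A : TangentSpace (𝓡 (2 * n + 1)) x →L[ℝ] TangentSpace (𝓡 (2 * n + 1)) x}
    (hA : Module.finrank ℝ (LinearMap.range A.toLinearMap) = 2 * n) :
    Module.finrank ℝ (LinearMap.ker A.toLinearMap) = 1 := by
  have : FiniteDimensional ℝ (TangentSpace (𝓡 (2 * n + 1)) x) :=
    inferInstanceAs (FiniteDimensional ℝ (EuclideanSpace ℝ (Fin (2 * n + 1))))
  have h1 := LinearMap.finrank_range_add_finrank_ker A.toLinearMap
  have h2 : Module.finrank ℝ (TangentSpace (𝓡 (2 * n + 1)) x) = 2 * n + 1 :=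
    finrank_euclideanSpace_fin
  omega

/-! ### The kernel line of `θ` and its unit sections. -/

section KernelField

variable {n : ℕ} {M : Type*} [TopologicalSpace M]
  [ChartedSpace (EuclideanSpace ℝ (Fin (2 * n + 1))) M] [IsManifold (𝓡 (2 * n + 1)) ∞ M]
  {g : RMetric (2 * n + 1) M}
  {θ : Π x : M, TangentSpace (𝓡 (2 * n + 1)) x →L[ℝ] TangentSpace (𝓡 (2 * n + 1)) x}

theorem exists_unit_mem_ker (g : RMetric (2 * n + 1) M) {x : M}
    {A : TangentSpace (𝓡 (2 * n + 1)) x →L[ℝ] TangentSpace (𝓡 (2 * n + 1)) x}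
    (hA : Module.finrank ℝ (LinearMap.range A.toLinearMap) = 2 * n) :
    ∃ k, A k = 0 ∧ g.inner x k k = 1 := by
  obtain ⟨⟨k, hk⟩, hk0, -⟩ := finrank_eq_one_iff'.1 (finrank_ker_of_finrank_range hA)
  have hk1 : k ≠ 0 := fun h ↦ hk0 (Subtype.ext h)
  have hpos := g.pos x k hk1
  refine ⟨(√(g.inner x k k))⁻¹ • k, ?_, ?_⟩
  · rw [map_smul, show A k = 0 from hk, smul_zero]
  · have : √(g.inner x k k) ≠ 0 := (Real.sqrt_pos.2 hpos).ne'
    simp only [map_smul, smul_apply, smul_eq_mul]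
    field_simp
    exact (Real.sq_sqrt hpos.le).symm

theorem eq_smul_of_mem_ker {x : M}
    {A : TangentSpace (𝓡 (2 * n + 1)) x →L[ℝ] TangentSpace (𝓡 (2 * n + 1)) x}
    (hA : Module.finrank ℝ (LinearMap.range A.toLinearMap) = 2 * n)
    {k w : TangentSpace (𝓡 (2 * n + 1)) x} (hk : A k = 0) (hk1 : g.inner x k k = 1)
    (hw : A w = 0) : w = g.inner x k w • k := by
  have hk0 : (⟨k, hk⟩ : LinearMap.ker A.toLinearMap) ≠ 0 := by
    intro h
    have : k = 0 := congrArg Subtype.val h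
    simp [this] at hk1
  obtain ⟨c, hc⟩ := (finrank_eq_one_iff_of_nonzero' _ hk0).1 (finrank_ker_of_finrank_range hA)
    ⟨w, hw⟩
  have hc' : c • k = w := congrArg Subtype.val hc
  rw [← hc', map_smul, smul_eq_mul, hk1, mul_one]

theorem IsUnitKernelField.apply_eq_zero {ξ : Π x : M, TangentSpace (𝓡 (2 * n + 1)) x}
    (h : IsUnitKernelField g θ ξ) (x : M) : θ x (ξ x) = 0 :=
  g.ext_inner fun u ↦ by
    rw [map_zero]
    exact congrArg (fun β : TangentSpace (𝓡 (2 * n + 1)) x →L[ℝ] ℝ ↦ β u) (h.mem_ker x)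

/-- A unit section of the line bundle `ker θ` is parallel if `θ` is. -/
theorem IsUnitKernelField.leviCivita_eq_zero {ξ : Π x : M, TangentSpace (𝓡 (2 * n + 1)) x}
    (h : IsUnitKernelField g θ ξ)
    (hrank : ∀ x, Module.finrank ℝ (LinearMap.range (θ x).toLinearMap) = 2 * n)
    (hθ : IsParallelEndo g.leviCivita θ) (x : M) : g.leviCivita ξ x = 0 := by
  refine g.lcDeriv_ext fun X Z hX hZ ↦ ?_
  have h1 : θ x (g.leviCivita ξ x (X x)) = 0 := by
    rw [← hθ.leviCivita_apply h.smooth]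
    have : (fun y ↦ θ y (ξ y)) = 0 := funext h.apply_eq_zero
    rw [this, g.leviCivita.zero]
    rfl
  -- Differentiating the constant `g(ξ, ξ) = 1` shows that `∇ξ` is orthogonal to `ξ`; by `h1` it
  -- also lies in the line `ℝξ`.
  have h2 := g.leviCivita_metric hX (h.smooth.fieldMDiffAt x) (h.smooth.fieldMDiffAt x)
  have h3 : (fun y ↦ g.inner y (ξ y) (ξ y)) = fun _ ↦ 1 := funext h.unit
  rw [h3, g.symm x _ (ξ x)] at h2
  have h4 : g.inner x (ξ x) (g.leviCivita ξ x (X x)) = 0 := by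
    rw [mvfderiv_const] at h2
    have : (0 : ℝ) = _ := h2
    linarith
  rw [eq_smul_of_mem_ker (hrank x) (h.apply_eq_zero x) (h.unit x) h1, h4]
  simp

end KernelField

/-! ### Smooth inversion of endomorphism fields. -/

section Inverse

variable {m : ℕ} {M : Type*} [TopologicalSpace M]
  [ChartedSpace (EuclideanSpace ℝ (Fin m)) M] [IsManifold (𝓡 m) ∞ M]

/-- The vector field `X` is smooth at `x`. -/
abbrev FieldSmoothAt (X : Π x : M, TangentSpace (𝓡 m) x) (x : M) : Prop :=
  ContMDiffAt (𝓡 m) ((𝓡 m).prod 𝓘(ℝ, EuclideanSpace ℝ (Fin m))) ∞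
    (fun y ↦ TotalSpace.mk' (EuclideanSpace ℝ (Fin m)) y (X y)) x

/-- The `(1,1)`-tensor field `B` is smooth at `x`. -/
abbrev EndoSmoothAt (B : Π x : M, TangentSpace (𝓡 m) x →L[ℝ] TangentSpace (𝓡 m) x) (x : M) :
    Prop :=
  ContMDiffAt (𝓡 m)
    ((𝓡 m).prod 𝓘(ℝ, EuclideanSpace ℝ (Fin m) →L[ℝ] EuclideanSpace ℝ (Fin m))) ∞
    (fun y ↦ TotalSpace.mk' (EuclideanSpace ℝ (Fin m) →L[ℝ] EuclideanSpace ℝ (Fin m)) y (B y)) x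

theorem FieldSmoothAt.inner {g : RMetric m M} {X Y : Π x : M, TangentSpace (𝓡 m) x} {x : M}
    (hX : FieldSmoothAt X x) (hY : FieldSmoothAt Y x) :
    ContMDiffAt (𝓡 m) 𝓘(ℝ, ℝ) ∞ (fun y ↦ g.inner y (X y) (Y y)) x := by
  let : RiemannianBundle (fun x : M ↦ TangentSpace (𝓡 m) x) := ⟨g.toRiemannianMetric⟩
  exact ContMDiffAt.inner_bundle hX hY

/-- In a trivialization `B` becomes a smooth map into a fixed space of operators, where inversion is
smooth at invertible operators and the invertible ones form an open set. -/
theorem EndoSmoothAt.inverse_apply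
    {B : Π x : M, TangentSpace (𝓡 m) x →L[ℝ] TangentSpace (𝓡 m) x}
    {X : Π x : M, TangentSpace (𝓡 m) x} {x₀ : M} (hB : EndoSmoothAt B x₀)
    (hX : FieldSmoothAt X x₀) (h : (B x₀).IsInvertible) :
    FieldSmoothAt (fun x ↦ (B x).inverse (X x)) x₀ ∧ ∀ᶠ x in 𝓝 x₀, (B x).IsInvertible := by
  have hb := ((contMDiffAt_hom_bundle _).1 hB).2
  have hU : ∀ᶠ x in 𝓝 x₀, x ∈ (trivializationAt (EuclideanSpace ℝ (Fin m))
      (fun x : M ↦ TangentSpace (𝓡 m) x) x₀).baseSet :=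
    (trivializationAt (EuclideanSpace ℝ (Fin m))
      (fun x : M ↦ TangentSpace (𝓡 m) x) x₀).open_baseSet.mem_nhds
        (mem_baseSet_trivializationAt _ _ x₀)
  have hinv : (ContinuousLinearMap.inCoordinates (EuclideanSpace ℝ (Fin m))
      (fun x : M ↦ TangentSpace (𝓡 m) x) (EuclideanSpace ℝ (Fin m))
      (fun x : M ↦ TangentSpace (𝓡 m) x) x₀ x₀ x₀ x₀ (B x₀)).IsInvertible := by
    rw [ContinuousLinearMap.inCoordinates_eq hU.self_of_nhds hU.self_of_nhds]
    exact ContinuousLinearMap.isInvertible_equiv.comp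
      (h.comp ContinuousLinearMap.isInvertible_equiv)
  have hb' := (hinv.contDiffAt_map_inverse (n := ∞)).contMDiffAt.comp x₀ hb
  constructor
  · refine ContMDiffAt.clm_bundle_apply (b := fun x : M ↦ x)
      (E₁ := fun x : M ↦ TangentSpace (𝓡 m) x) (E₂ := fun x : M ↦ TangentSpace (𝓡 m) x)
      (ϕ := fun x ↦ (B x).inverse) ?_ hX
    refine (contMDiffAt_hom_bundle _).2 ⟨contMDiffAt_id, hb'.congr_of_eventuallyEq ?_⟩
    filter_upwards [hU] with x hx
    simp only [Function.comp_apply]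
    rw [ContinuousLinearMap.inCoordinates_eq hx hx, ContinuousLinearMap.inCoordinates_eq hx hx]
    simp only [ContinuousLinearMap.inverse_equiv_comp, ContinuousLinearMap.inverse_comp_equiv,
      ContinuousLinearEquiv.symm_symm]
    rfl
  · obtain ⟨e, he⟩ := hinv
    have hopen := hb.continuousAt.eventually_mem
      (he ▸ ContinuousLinearEquiv.nhds e)
    filter_upwards [hU, hopen] with x hx hx'
    obtain ⟨f, hf⟩ := hx'
    rw [ContinuousLinearMap.inCoordinates_eq hx hx] at hf
    have : (f : EuclideanSpace ℝ (Fin m) →L[ℝ] EuclideanSpace ℝ (Fin m)).IsInvertible :=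
      ContinuousLinearMap.isInvertible_equiv
    rw [hf] at this
    simpa using this

/-- The rank-one term `X♭ ⊗ X` is the correction that makes `θ` invertible when `X` is a unit kernel
vector at `x₀`. -/
theorem EndoSmoothAt.add_flat_smulRight {g : RMetric m M}
    {θ : Π x : M, TangentSpace (𝓡 m) x →L[ℝ] TangentSpace (𝓡 m) x}
    {X : Π x : M, TangentSpace (𝓡 m) x} {x₀ : M} (hθ : EndoSmoothAt θ x₀)
    (hX : FieldSmoothAt X x₀) :
    EndoSmoothAt (fun x ↦ θ x + (g.inner x (X x)).smulRight (X x)) x₀ := by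
  refine ContMDiffAt.add_section hθ ?_
  have hα := ContMDiffAt.clm_bundle_apply (b := fun x : M ↦ x)
    (E₁ := fun x : M ↦ TangentSpace (𝓡 m) x)
    (E₂ := fun x : M ↦ TangentSpace (𝓡 m) x →L[ℝ] ℝ) (g.contMDiff x₀) hX
  have hα' := ((contMDiffAt_hom_bundle _).1 hα).2
  have hX' := (contMDiffAt_totalSpace.1 hX).2
  refine (contMDiffAt_hom_bundle _).2 ⟨contMDiffAt_id, ?_⟩
  refine (((contMDiffAt_const (c := ContinuousLinearMap.smulRightL ℝ _ _)).clm_apply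
    hα').clm_apply hX').congr_of_eventuallyEq ?_
  filter_upwards [(trivializationAt (EuclideanSpace ℝ (Fin m))
      (fun x : M ↦ TangentSpace (𝓡 m) x) x₀).open_baseSet.mem_nhds
        (mem_baseSet_trivializationAt _ _ x₀)] with x hx
  refine ContinuousLinearMap.ext fun u ↦ ?_
  simp [ContinuousLinearMap.inCoordinates, Trivialization.coe_linearMapAt_of_mem _ hx]

end Inverse

/-! ### Smooth local unit sections of the kernel. -/

section LocalKernelField

variable {n : ℕ} {M : Type*} [TopologicalSpace M]
  [ChartedSpace (EuclideanSpace ℝ (Fin (2 * n + 1))) M] [IsManifold (𝓡 (2 * n + 1)) ∞ M]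
  {g : RMetric (2 * n + 1) M}
  {θ : Π x : M, TangentSpace (𝓡 (2 * n + 1)) x →L[ℝ] TangentSpace (𝓡 (2 * n + 1)) x}

/-- By skew-symmetry the image of `θ` is orthogonal to `k`. Pairing `θ v + g(k, v) k = 0` with `k`
gives `g(k, v) = 0`, hence `θ v = 0`; then `v` is a multiple of `k` orthogonal to `k`. -/
theorem isInvertible_add_flat_smulRight {x : M}
    (hskew : ∀ u v, g.inner x (θ x u) v = -g.inner x u (θ x v))
    (hrank : Module.finrank ℝ (LinearMap.range (θ x).toLinearMap) = 2 * n)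
    {k : TangentSpace (𝓡 (2 * n + 1)) x} (hk : θ x k = 0) (hk1 : g.inner x k k = 1) :
    (θ x + (g.inner x k).smulRight k).IsInvertible := by
  have : FiniteDimensional ℝ (TangentSpace (𝓡 (2 * n + 1)) x) :=
    inferInstanceAs (FiniteDimensional ℝ (EuclideanSpace ℝ (Fin (2 * n + 1))))
  have : T2Space (TangentSpace (𝓡 (2 * n + 1)) x) :=
    inferInstanceAs (T2Space (EuclideanSpace ℝ (Fin (2 * n + 1))))
  have hinj : Function.Injective (θ x + (g.inner x k).smulRight k).toLinearMap := by
    rw [← LinearMap.ker_eq_bot, LinearMap.ker_eq_bot']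
    intro v hv
    have hv' : θ x v + g.inner x k v • k = 0 := hv
    have h1 : g.inner x k (θ x v + g.inner x k v • k) = 0 := by rw [hv', map_zero]
    have h2 : g.inner x k (θ x v) = 0 := by
      have := hskew k v
      rw [hk] at this
      simp at this
      exact this
    rw [map_add, h2, map_smul, hk1] at h1
    have h3 : g.inner x k v = 0 := by simpa using h1
    rw [h3, zero_smul, add_zero] at hv'
    rw [eq_smul_of_mem_ker hrank hk hk1 hv', h3, zero_smul]
  exact ⟨(LinearEquiv.ofInjectiveEndo _ hinj).toContinuousLinearEquiv, rfl⟩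

/-- Here `y` need not lie in the kernel, so the lemma applies at points near `x₀`, where an
extension of a kernel vector may have left it. Pairing `hw` with a unit kernel vector `k` gives
`g(y, w) g(k, y) = g(k, y)`. If `g(k, y)` were zero, the invertible operator would kill `k`; so
`g(y, w) = 1`, and `hw` reduces to `θ w = 0`. -/
theorem mem_ker_of_add_flat_smulRight {x : M}
    (hskew : ∀ u v, g.inner x (θ x u) v = -g.inner x u (θ x v))
    (hrank : Module.finrank ℝ (LinearMap.range (θ x).toLinearMap) = 2 * n)
    {y w : TangentSpace (𝓡 (2 * n + 1)) x}
    (hinv : (θ x + (g.inner x y).smulRight y).IsInvertible)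
    (hw : θ x w + g.inner x y w • y = y) : θ x w = 0 ∧ w ≠ 0 := by
  obtain ⟨k, hk, hk1⟩ := exists_unit_mem_ker g hrank
  have h1 : g.inner x k (θ x w) = 0 := by
    have := hskew k w
    rw [hk] at this
    simp at this
    exact this
  have h2 : g.inner x y w * g.inner x k y = g.inner x k y := by
    have := congrArg (g.inner x k) hw
    rw [map_add, h1, map_smul, zero_add] at this
    exact this
  have h3 : g.inner x k y ≠ 0 := by
    intro h
    obtain ⟨e, he⟩ := hinv
    have h4 : e k = 0 := by
      change (e : TangentSpace (𝓡 (2 * n + 1)) x →L[ℝ] TangentSpace (𝓡 (2 * n + 1)) x) k = 0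
      rw [he]
      change θ x k + g.inner x y k • y = 0
      rw [hk, g.symm x y k, h, zero_smul, add_zero]
    have h5 : k = 0 := e.map_eq_zero_iff.1 h4
    simp [h5] at hk1
  have h4 : g.inner x y w = 1 := mul_right_cancel₀ h3 (h2.trans (one_mul _).symm)
  rw [h4, one_smul] at hw
  refine ⟨by simpa using hw, fun h ↦ ?_⟩
  simp [h] at h4

/-- The kernel of a smooth skew-symmetric endomorphism field of rank `2n` has a smooth unit
section near every point. -/
theorem exists_local_unit_kernel_field (hθ : IsSmoothEndo θ)
    (hskew : ∀ x u v, g.inner x (θ x u) v = -g.inner x u (θ x v))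
    (hrank : ∀ x, Module.finrank ℝ (LinearMap.range (θ x).toLinearMap) = 2 * n) (x₀ : M) :
    ∃ ζ : Π x : M, TangentSpace (𝓡 (2 * n + 1)) x, FieldSmoothAt ζ x₀ ∧
      ∀ᶠ x in 𝓝 x₀, θ x (ζ x) = 0 ∧ g.inner x (ζ x) (ζ x) = 1 := by
  obtain ⟨k, hk, hk1⟩ := exists_unit_mem_ker g (hrank x₀)
  let Y : Π x : M, TangentSpace (𝓡 (2 * n + 1)) x :=
    extend (EuclideanSpace ℝ (Fin (2 * n + 1))) k
  have hY : FieldSmoothAt Y x₀ := contMDiffAt_extend ..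
  have hYk : Y x₀ = k := extend_apply_self ..
  obtain ⟨hw, hinv⟩ := (EndoSmoothAt.add_flat_smulRight (g := g) (hθ x₀) hY).inverse_apply hY (by
    rw [hYk]
    exact isInvertible_add_flat_smulRight (hskew x₀) (hrank x₀) hk hk1)
  -- Solving `(θ + Y♭ ⊗ Y) w = Y` turns the arbitrary extension `Y` of `k` into a smooth
  -- nonvanishing kernel field near `x₀`, which is then normalized.
  set w : Π x : M, TangentSpace (𝓡 (2 * n + 1)) x :=
    fun x ↦ (θ x + (g.inner x (Y x)).smulRight (Y x)).inverse (Y x)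
  have hker : ∀ᶠ x in 𝓝 x₀, θ x (w x) = 0 ∧ w x ≠ 0 := by
    filter_upwards [hinv] with x hx
    refine mem_ker_of_add_flat_smulRight (hskew x) (hrank x) hx ?_
    exact hx.self_apply_inverse (Y x)
  have hpos := g.pos x₀ _ hker.self_of_nhds.2
  have hr : ContMDiffAt (𝓡 (2 * n + 1)) 𝓘(ℝ, ℝ) ∞
      (fun x ↦ (√(g.inner x (w x) (w x)))⁻¹) x₀ :=
    ContMDiffAt.comp (g := fun t : ℝ ↦ (√t)⁻¹) x₀
      ((Real.contDiffAt_sqrt hpos.ne').inv (Real.sqrt_pos.2 hpos).ne').contMDiffAt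
      (hw.inner (g := g) hw)
  refine ⟨_, hr.smul_section hw, ?_⟩
  filter_upwards [hker] with x hx
  have hpos := g.pos x _ hx.2
  refine ⟨?_, ?_⟩
  · change θ x ((√(g.inner x (w x) (w x)))⁻¹ • w x) = 0
    rw [map_smul, hx.1, smul_zero]
  · have : √(g.inner x (w x) (w x)) ≠ 0 := (Real.sqrt_pos.2 hpos).ne'
    simp only [Pi.smul_apply', map_smul, smul_apply, smul_eq_mul]
    field_simp
    exact (Real.sq_sqrt hpos.le).symm

end LocalKernelField

/-! ### Linear algebra: `η ∧ Ω^n` does not vanish. -/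

section Wedge

/-- A permutation of `Option (ι × Fin 2)` contributing to the top power of the standard symplectic
form contributes with a positive sign. -/
theorem sign_mul_prod_symplectic_nonneg {ι : Type*} [Fintype ι] [DecidableEq ι]
    (ρ : Equiv.Perm (Option (ι × Fin 2))) {η : Option (ι × Fin 2) → ℝ}
    {Ω : Option (ι × Fin 2) → Option (ι × Fin 2) → ℝ} (hη : 0 ≤ η none)
    (hη' : ∀ p, η (some p) = 0)
    (hΩ : ∀ p q, Ω (some p) (some q) = if p.1 = q.1 then ((q.2 : ℕ) : ℝ) - (p.2 : ℕ) else 0) :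
    0 ≤ ((Equiv.Perm.sign ρ : ℤ) : ℝ) *
      (η (ρ none) * ∏ i, Ω (ρ (some (i, 0))) (ρ (some (i, 1)))) := by
  by_cases h0 : η (ρ none) * ∏ i, Ω (ρ (some (i, 0))) (ρ (some (i, 1))) = 0
  · rw [h0, mul_zero]
  obtain ⟨h1, h2⟩ := mul_ne_zero_iff.1 h0
  -- A nonzero term forces `ρ` to fix `none`, since `η` vanishes elsewhere, and to send each pair
  -- `{(i, 0), (i, 1)}` onto such a pair, since `Ω` vanishes between different pairs.
  have hnone : ρ none = none := by
    cases hp : ρ none with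
    | none => rfl
    | some p => exact absurd (hη' p) (hp ▸ h1)
  obtain ⟨κ, rfl⟩ : ∃ κ : Equiv.Perm (ι × Fin 2), ρ = Equiv.optionCongr κ := by
    refine ⟨Equiv.removeNone ρ, ?_⟩
    rw [map_equiv_removeNone, hnone, Equiv.swap_self]
    rfl
  have hne : ∀ i, Ω (some (κ (i, 0))) (some (κ (i, 1))) ≠ 0 := fun i ↦
    Finset.prod_ne_zero_iff.1 h2 i (Finset.mem_univ i)
  have hfst : ∀ i b, (κ (i, b)).1 = (κ (i, 0)).1 := by
    intro i b
    have : (κ (i, 0)).1 = (κ (i, 1)).1 := by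
      by_contra h
      exact hne i (by rw [hΩ, if_neg h])
    fin_cases b
    · rfl
    · exact this.symm
  have hs : ∀ i, Function.Injective fun b ↦ (κ (i, b)).2 := by
    intro i b c hbc
    have : κ (i, b) = κ (i, c) := Prod.ext ((hfst i b).trans (hfst i c).symm) hbc
    exact congrArg Prod.snd (κ.injective this)
  let s : ι → Equiv.Perm (Fin 2) := fun i ↦
    Equiv.ofBijective _ (Finite.injective_iff_bijective.1 (hs i))
  have hτ : Function.Injective fun i ↦ (κ (i, 0)).1 := by
    intro i j hij
    obtain ⟨b, hb⟩ := (s i).surjective (κ (j, 0)).2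
    have : κ (i, b) = κ (j, 0) := Prod.ext ((hfst i b).trans hij) hb
    exact congrArg Prod.fst (κ.injective this)
  let τ : Equiv.Perm ι := Equiv.ofBijective _ (Finite.injective_iff_bijective.1 hτ)
  -- `κ` permutes inside each pair by `s i`, then moves whole pairs by `τ`. As `τ` acts on both
  -- members of a pair, its sign enters squared and disappears.
  have hκ : κ = Equiv.prodCongrLeft (fun _ : Fin 2 ↦ τ) * Equiv.prodCongrRight s :=
    Equiv.ext fun p ↦ Prod.ext (hfst p.1 p.2) rfl
  have hsign : Equiv.Perm.sign κ = ∏ i, Equiv.Perm.sign (s i) := by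
    rw [hκ, Equiv.Perm.sign_mul, Equiv.Perm.sign_prodCongrLeft, Equiv.Perm.sign_prodCongrRight]
    simp
  have hfac : ∀ i, Ω (some (κ (i, 0))) (some (κ (i, 1))) = ((Equiv.Perm.sign (s i) : ℤ) : ℝ) := by
    intro i
    rw [hΩ, if_pos (hfst i 1).symm]
    have key : ∀ t : Equiv.Perm (Fin 2),
        (((t 1 : Fin 2) : ℕ) : ℤ) - ((t 0 : Fin 2) : ℕ) = Equiv.Perm.sign t := by decide
    exact_mod_cast key (s i)
  simp only [Equiv.optionCongr_apply, Option.map_some, Option.map_none, Equiv.optionCongr_sign,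
    hfac, hsign]
  have hcast : (((∏ i, Equiv.Perm.sign (s i) : ℤˣ) : ℤ) : ℝ)
      = ∏ i, ((Equiv.Perm.sign (s i) : ℤ) : ℝ) := by push_cast; rfl
  rw [hcast]
  -- Each factor `Ω` equals `sign (s i)`, so the term is `η none` times the square of the product of
  -- these signs.
  nlinarith [mul_nonneg hη (mul_self_nonneg (∏ i, ((Equiv.Perm.sign (s i) : ℤ) : ℝ)))]

variable {V : Type*} [AddCommGroup V] [Module ℝ V]

/-- Symplectic Gram–Schmidt, adding one pair at a time. Only the values of `e` below `k` matter;
indexing by `ℕ` lets the induction extend it by `Function.update`. -/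
theorem exists_symplectic_family [FiniteDimensional ℝ V] {n : ℕ}
    (hV : Module.finrank ℝ V = 2 * n + 1) {Ω : V →ₗ[ℝ] V →ₗ[ℝ] ℝ} (hΩ : ∀ v, Ω v v = 0) {ξ : V}
    (hker : ∀ u, (∀ w, Ω u w = 0) → ∃ c : ℝ, u = c • ξ) (k : ℕ) (hk : k ≤ n) :
    ∃ e : ℕ → Fin 2 → V, ∀ i < k, ∀ j < k, ∀ b c,
      Ω (e i b) (e j c) = if i = j then ((c : ℕ) : ℝ) - (b : ℕ) else 0 := by
  have hanti : ∀ u w, Ω u w = -Ω w u := fun u w ↦ by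
    have := hΩ (u + w)
    simp only [map_add, LinearMap.add_apply, hΩ] at this
    linarith
  induction k with
  | zero => exact ⟨0, by simp⟩
  | succ k ih =>
    obtain ⟨e, he⟩ := ih (by omega)
    -- The `Ω`-projection onto the span of the pairs found so far: `u - S u` is `Ω`-orthogonal to
    -- all of them.
    let S : V → V := fun u ↦
      ∑ i ∈ Finset.range k, (Ω u (e i 1) • e i 0 - Ω u (e i 0) • e i 1)
    have hS : ∀ u, ∀ j < k, ∀ c, Ω (u - S u) (e j c) = 0 := by
      intro u j hj c
      have : Ω (S u) (e j c) = ∑ i ∈ Finset.range k, if i = j then Ω u (e j c) else 0 := by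
        simp only [S, map_sum, LinearMap.sum_apply]
        refine Finset.sum_congr rfl fun i hi ↦ ?_
        have hi' := Finset.mem_range.1 hi
        simp only [map_sub, map_smul, LinearMap.sub_apply, LinearMap.smul_apply,
          he i hi' j hj, smul_eq_mul]
        split_ifs with h
        · subst h
          fin_cases c <;> simp
        · simp
      rw [map_sub, LinearMap.sub_apply, this, Finset.sum_ite_eq' (Finset.range k) j,
        if_pos (Finset.mem_range.2 hj), sub_self]
    have hS' : ∀ u w, Ω (u - S u) (S w) = 0 := by
      intro u w
      rw [map_sum]
      refine Finset.sum_eq_zero fun i hi ↦ ?_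
      rw [map_sub, map_smul, map_smul, hS u i (Finset.mem_range.1 hi),
        hS u i (Finset.mem_range.1 hi)]
      simp
    obtain ⟨u, w, huw⟩ : ∃ u w, Ω (u - S u) (w - S w) ≠ 0 := by
      -- If `Ω` vanished on all residuals, each `u - S u` would be a multiple of `ξ`, and `ξ` with
      -- the `k` pairs would span `V`: `2k + 1` vectors for dimension `2n + 1`, with `k < n`.
      by_contra! h
      let F : Option (Fin k × Fin 2) → V := fun o ↦ o.elim ξ fun p ↦ e p.1 p.2
      have hspan : Submodule.span ℝ (Set.range F) = ⊤ := by
        refine eq_top_iff.2 fun u _ ↦ ?_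
        obtain ⟨c, hc⟩ := hker (u - S u) fun w ↦ by
          have := h u w
          rw [map_sub, hS', sub_zero] at this
          exact this
        rw [sub_eq_iff_eq_add.1 hc]
        refine add_mem (Submodule.smul_mem _ _ (Submodule.subset_span ⟨none, rfl⟩))
          (Submodule.sum_mem _ fun i hi ↦ sub_mem ?_ ?_)
        · exact Submodule.smul_mem _ _
            (Submodule.subset_span ⟨some (⟨i, Finset.mem_range.1 hi⟩, 0), rfl⟩)
        · exact Submodule.smul_mem _ _
            (Submodule.subset_span ⟨some (⟨i, Finset.mem_range.1 hi⟩, 1), rfl⟩)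
      have h1 := finrank_range_le_card (R := ℝ) F
      rw [Set.finrank, hspan, finrank_top, hV] at h1
      simp at h1
      omega
    set a := Ω (u - S u) (w - S w) with ha
    -- The factor `a⁻¹` normalizes the new pair to `Ω = 1`.
    refine ⟨Function.update e k ![a⁻¹ • (u - S u), w - S w], fun i hi j hj b c ↦ ?_⟩
    have hE : ∀ x, ∀ j < k, ∀ c, Ω (e j c) (x - S x) = 0 := fun x j hj c ↦ by
      rw [hanti, hS x j hj, neg_zero]
    rcases Nat.lt_succ_iff_lt_or_eq.1 hi with hi' | rfl <;>
      rcases Nat.lt_succ_iff_lt_or_eq.1 hj with hj' | hj'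
    · rw [Function.update_of_ne hi'.ne, Function.update_of_ne hj'.ne, he i hi' j hj']
    · subst hj'
      rw [Function.update_of_ne hi'.ne, Function.update_self, if_neg hi'.ne]
      fin_cases c <;> simp [hE _ i hi', -map_sub]
    · rw [Function.update_of_ne hj'.ne, Function.update_self, if_neg hj'.ne']
      fin_cases b <;> simp [hS _ j hj', -map_sub]
    · subst hj'
      rw [Function.update_self, if_pos rfl]
      fin_cases b <;> fin_cases c
      · simp [hΩ, -map_sub]
      · simp only [Fin.zero_eta, Fin.mk_one, Matrix.cons_val_zero, Matrix.cons_val_one, map_smul,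
          LinearMap.smul_apply, ← ha, smul_eq_mul]
        simp [huw]
      · simp only [Fin.zero_eta, Fin.mk_one, Matrix.cons_val_zero, Matrix.cons_val_one, map_smul]
        rw [hanti (w - S w), ← ha]
        simp [huw]
      · simp [hΩ, -map_sub]

/-- The map `w ↦ η(w none) ∏ i, Ω(w (i, 0), w (i, 1))`. -/
noncomputable def pairingMultilinear {ι : Type*} [Fintype ι] [DecidableEq ι] (η : V →ₗ[ℝ] ℝ)
    (Ω : V →ₗ[ℝ] V →ₗ[ℝ] ℝ) : MultilinearMap ℝ (fun _ : Option (ι × Fin 2) ↦ V) ℝ :=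
  MultilinearMap.mk' (fun w ↦ η (w none) * ∏ i, Ω (w (some (i, 0))) (w (some (i, 1))))
    (by
      intro w o x y
      cases o with
      | none => simp [add_mul]
      | some p =>
        obtain ⟨j, b⟩ := p
        -- Each slot occurs in exactly one factor, so only the factor `j` sees the update.
        simp only [← Finset.mul_prod_erase _ _ (Finset.mem_univ j)]
        have : ∀ z, ∏ i ∈ Finset.univ.erase j,
            Ω (Function.update w (some (j, b)) z (some (i, 0)))
              (Function.update w (some (j, b)) z (some (i, 1)))
            = ∏ i ∈ Finset.univ.erase j, Ω (w (some (i, 0))) (w (some (i, 1))) := fun z ↦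
          Finset.prod_congr rfl fun i hi ↦ by simp [Finset.ne_of_mem_erase hi]
        simp only [this]
        fin_cases b <;> simp <;> ring)
    (by
      intro w o c x
      cases o with
      | none => simp [mul_assoc]
      | some p =>
        obtain ⟨j, b⟩ := p
        simp only [← Finset.mul_prod_erase _ _ (Finset.mem_univ j)]
        have : ∀ z, ∏ i ∈ Finset.univ.erase j,
            Ω (Function.update w (some (j, b)) z (some (i, 0)))
              (Function.update w (some (j, b)) z (some (i, 1)))
            = ∏ i ∈ Finset.univ.erase j, Ω (w (some (i, 0))) (w (some (i, 1))) := fun z ↦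
          Finset.prod_congr rfl fun i hi ↦ by simp [Finset.ne_of_mem_erase hi]
        simp only [this]
        fin_cases b <;> simp <;> ring)

/-- `none ↦ 0` and `(i, b) ↦ 2 i + b + 1`. -/
noncomputable def optionProdEquivFin (n : ℕ) : Option (Fin n × Fin 2) ≃ Fin (2 * n + 1) :=
  Equiv.ofBijective
    (fun o ↦ o.elim 0 fun p ↦ ⟨2 * p.1 + p.2 + 1, by omega⟩)
    ((Fintype.bijective_iff_injective_and_card _).2 ⟨by
      rintro (_ | ⟨i, b⟩) (_ | ⟨j, c⟩) h <;>
        simp only [Option.elim, Fin.ext_iff, Fin.val_zero] at h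
      · rfl
      · omega
      · omega
      · rw [Option.some_inj, Prod.ext_iff, Fin.ext_iff, Fin.ext_iff]
        dsimp only
        omega, by simp; ring⟩)

/-- `η ∧ Ω^n` as an alternating map. -/
noncomputable def wedgePowAlternating (n : ℕ) (η : V →ₗ[ℝ] ℝ) (Ω : V →ₗ[ℝ] V →ₗ[ℝ] ℝ) :
    V [⋀^Fin (2 * n + 1)]→ₗ[ℝ] ℝ :=
  (1 / 2 ^ n : ℝ) • MultilinearMap.alternatization
    ((pairingMultilinear η Ω).domDomCongr (optionProdEquivFin n))

/-- Writing `wedgePow` as an alternating map makes the determinant rule for a change of frame and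
the nonvanishing on bases available. -/
theorem wedgePowAlternating_apply (n : ℕ) (η : V →ₗ[ℝ] ℝ) (Ω : V →ₗ[ℝ] V →ₗ[ℝ] ℝ)
    (v : Fin (2 * n + 1) → V) :
    wedgePowAlternating n η Ω v = wedgePow n (fun u ↦ η u) (fun u w ↦ Ω u w) v := by
  rw [wedgePowAlternating, wedgePow, AlternatingMap.smul_apply,
    MultilinearMap.alternatization_apply, smul_eq_mul]
  congr 1
  refine Finset.sum_congr rfl fun σ _ ↦ ?_
  rw [Units.smul_def, zsmul_eq_mul]
  rfl

/-- `η ∧ Ω^n ≠ 0` if the alternating form `Ω` has kernel spanned by `ξ` and `η(ξ) = 1`. -/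
theorem wedgePowAlternating_ne_zero [FiniteDimensional ℝ V] {n : ℕ}
    (hV : Module.finrank ℝ V = 2 * n + 1) {Ω : V →ₗ[ℝ] V →ₗ[ℝ] ℝ} (hΩ : ∀ v, Ω v v = 0) {ξ : V}
    (hξ : Ω ξ = 0) (hker : ∀ u, (∀ w, Ω u w = 0) → ∃ c : ℝ, u = c • ξ) {η : V →ₗ[ℝ] ℝ}
    (hη : η ξ = 1) : wedgePowAlternating n η Ω ≠ 0 := by
  obtain ⟨e, he⟩ := exists_symplectic_family hV hΩ hker n le_rfl
  have hξ' : ∀ u, Ω u ξ = 0 := fun u ↦ by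
    have := hΩ (u + ξ)
    simpa [hΩ, hξ] using this
  -- Subtracting multiples of `ξ` puts the pairs in `ker η`; the values of `Ω` do not change,
  -- because `ξ` lies in its kernel.
  let W : Option (Fin n × Fin 2) → V := fun o ↦ o.elim ξ fun p ↦ e p.1 p.2 - η (e p.1 p.2) • ξ
  have hWη : ∀ p, η (W (some p)) = 0 := fun p ↦ by simp [W, hη]
  have hWΩ : ∀ p q, Ω (W (some p)) (W (some q))
      = if p.1 = q.1 then ((q.2 : ℕ) : ℝ) - (p.2 : ℕ) else 0 := fun p q ↦ by
    simp [W, hξ, hξ', he _ p.1.2 _ q.1.2, Fin.ext_iff]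
  let E := optionProdEquivFin n
  have hpos : 0 < wedgePowAlternating n η Ω (W ∘ E.symm) := by
    rw [wedgePowAlternating, AlternatingMap.smul_apply, MultilinearMap.alternatization_apply,
      smul_eq_mul]
    -- On this basis no term of the sum is negative, and the identity contributes `1`.
    refine mul_pos (by positivity) (Finset.sum_pos' (fun σ _ ↦ ?_) ⟨1, Finset.mem_univ _, ?_⟩)
    · have := sign_mul_prod_symplectic_nonneg (E.symm.permCongr σ) (η := fun o ↦ η (W o))
        (Ω := fun o o' ↦ Ω (W o) (W o')) (by simp [W, hη]) hWη hWΩ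
      rw [Equiv.Perm.sign_permCongr] at this
      rw [Units.smul_def, zsmul_eq_mul]
      exact this
    · rw [Equiv.Perm.sign_one, one_smul]
      change 0 < η (W (E.symm (E none))) *
        ∏ i, Ω (W (E.symm (E (some (i, 0))))) (W (E.symm (E (some (i, 1)))))
      simp only [Equiv.symm_apply_apply, hWΩ]
      simp [W, hη]
  intro h
  rw [h] at hpos
  exact lt_irrefl _ hpos

end Wedge

/-! ### Coordinate frames and the Jacobian rule for top forms. -/

section ChartFrame

variable {m : ℕ} {M : Type*} [TopologicalSpace M]
  [ChartedSpace (EuclideanSpace ℝ (Fin m)) M]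

/-- The `i`-th coordinate vector field of the chart `φ`. -/
noncomputable def chartFrame (φ : OpenPartialHomeomorph M (EuclideanSpace ℝ (Fin m))) (i : Fin m) :
    Π x : M, TangentSpace (𝓡 m) x :=
  mpullback (𝓡 m) (𝓡 m) φ
    (fun _ ↦ (EuclideanSpace.basisFun (Fin m) ℝ i : EuclideanSpace ℝ (Fin m)))

theorem mdifferentiable_of_mem_maximalAtlas
    {φ : OpenPartialHomeomorph M (EuclideanSpace ℝ (Fin m))}
    (hφ : φ ∈ IsManifold.maximalAtlas (𝓡 m) ∞ M) : φ.MDifferentiable (𝓡 m) (𝓡 m) :=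
  ⟨(contMDiffOn_of_mem_maximalAtlas hφ).mdifferentiableOn (by simp),
    (contMDiffOn_symm_of_mem_maximalAtlas hφ).mdifferentiableOn (by simp)⟩

/-- Consequently the sign of a top form on coordinate frames is the same for all charts of an
oriented atlas. -/
theorem AlternatingMap.chartFrame_eq_det_mul
    {φ ψ : OpenPartialHomeomorph M (EuclideanSpace ℝ (Fin m))}
    (hφ : φ ∈ IsManifold.maximalAtlas (𝓡 m) ∞ M) (hψ : ψ ∈ IsManifold.maximalAtlas (𝓡 m) ∞ M)
    {x : M} (hxφ : x ∈ φ.source) (hxψ : x ∈ ψ.source)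
    (f : TangentSpace (𝓡 m) x [⋀^Fin m]→ₗ[ℝ] ℝ) :
    f (fun i ↦ chartFrame φ i x)
      = (fderiv ℝ (ψ ∘ φ.symm) (φ x)).det * f (fun i ↦ chartFrame ψ i x) := by
  have dφ := mdifferentiable_of_mem_maximalAtlas hφ
  have dψ := mdifferentiable_of_mem_maximalAtlas hψ
  let D : EuclideanSpace ℝ (Fin m) →L[ℝ] EuclideanSpace ℝ (Fin m) :=
    fderiv ℝ (ψ ∘ φ.symm) (φ x)
  let L : EuclideanSpace ℝ (Fin m) →ₗ[ℝ] TangentSpace (𝓡 m) x :=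
    (mfderiv (𝓡 m) (𝓡 m) ψ x).inverse.toLinearMap
  have hinvφ : (mfderiv (𝓡 m) (𝓡 m) φ x).IsInvertible := ⟨dφ.mfderiv hxφ, rfl⟩
  have hinvψ : (mfderiv (𝓡 m) (𝓡 m) ψ x).IsInvertible := ⟨dψ.mfderiv hxψ, rfl⟩
  have hsymm : φ.symm (φ x) = x := φ.left_inv hxφ
  have hdT : MDifferentiableAt (𝓡 m) (𝓡 m) (ψ ∘ φ.symm) (φ x) :=
    MDifferentiableAt.comp (φ x) (by rw [hsymm]; exact dψ.mdifferentiableAt hxψ)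
      (dφ.mdifferentiableAt_symm (φ.map_source hxφ))
  have hchain : ∀ v : TangentSpace (𝓡 m) x, mfderiv (𝓡 m) (𝓡 m) ψ x v
      = D (mfderiv (𝓡 m) (𝓡 m) φ x v) := by
    intro v
    have h1 : mfderiv (𝓡 m) (𝓡 m) ((ψ ∘ φ.symm) ∘ φ) x = mfderiv (𝓡 m) (𝓡 m) ψ x := by
      refine Filter.EventuallyEq.mfderiv_eq ?_
      filter_upwards [φ.open_source.mem_nhds hxφ] with y hy
      simp [φ.left_inv hy]
    have h2 := mfderiv_comp x hdT (dφ.mdifferentiableAt hxφ)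
    rw [h1, mfderiv_eq_fderiv] at h2
    exact congrArg (fun T ↦ T v) h2
  -- Both frames are images under `L = (dψ)⁻¹`: the one of `ψ` of the standard basis, the one of `φ`
  -- of that basis moved by the Jacobian `D`.
  have hframe : (fun i ↦ chartFrame φ i x)
      = fun i ↦ L (D (EuclideanSpace.basisFun (Fin m) ℝ i)) := by
    funext i
    have h1 : D (EuclideanSpace.basisFun (Fin m) ℝ i)
        = mfderiv (𝓡 m) (𝓡 m) ψ x (chartFrame φ i x) := by
      rw [hchain]
      exact congrArg D (hinvφ.self_apply_inverse _).symm
    rw [h1]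
    exact (hinvψ.inverse_apply_self _).symm
  have hframe' : (fun i ↦ chartFrame ψ i x) = fun i ↦ L (EuclideanSpace.basisFun (Fin m) ℝ i) := rfl
  have key := (f.compLinearMap L).eq_smul_basis_det (EuclideanSpace.basisFun (Fin m) ℝ).toBasis
  have key' := congrArg (fun F ↦ F fun i ↦ D (EuclideanSpace.basisFun (Fin m) ℝ i)) key
  have hdet : (EuclideanSpace.basisFun (Fin m) ℝ).toBasis.det
      (fun i ↦ D (EuclideanSpace.basisFun (Fin m) ℝ i)) = D.det := by
    have := (EuclideanSpace.basisFun (Fin m) ℝ).toBasis.det_comp D.toLinearMap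
      (EuclideanSpace.basisFun (Fin m) ℝ).toBasis
    rw [Module.Basis.det_self, mul_one] at this
    rw [← OrthonormalBasis.coe_toBasis]
    exact this
  rw [hframe, hframe']
  simp only [AlternatingMap.compLinearMap_apply, AlternatingMap.smul_apply, smul_eq_mul, hdet,
    OrthonormalBasis.coe_toBasis] at key'
  rw [mul_comm]
  exact key'

theorem AlternatingMap.chartFrame_ne_zero
    {φ : OpenPartialHomeomorph M (EuclideanSpace ℝ (Fin m))}
    (hφ : φ ∈ IsManifold.maximalAtlas (𝓡 m) ∞ M) {x : M} (hx : x ∈ φ.source)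
    {f : TangentSpace (𝓡 m) x [⋀^Fin m]→ₗ[ℝ] ℝ} (hf : f ≠ 0) :
    f (fun i ↦ chartFrame φ i x) ≠ 0 := by
  let e := (mdifferentiable_of_mem_maximalAtlas hφ).mfderiv hx
  have h1 : ∀ i, chartFrame φ i x = e.symm (EuclideanSpace.basisFun (Fin m) ℝ i) := by
    intro i
    exact congrArg (fun T : TangentSpace (𝓡 m) (φ x) →L[ℝ] TangentSpace (𝓡 m) x ↦
      T (EuclideanSpace.basisFun (Fin m) ℝ i)) (ContinuousLinearMap.inverse_equiv e)
  let L : EuclideanSpace ℝ (Fin m) ≃ₗ[ℝ] TangentSpace (𝓡 m) x := e.symm.toLinearEquiv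
  let b : Module.Basis (Fin m) ℝ (TangentSpace (𝓡 m) x) :=
    (EuclideanSpace.basisFun (Fin m) ℝ).toBasis.map L
  have h2 : (fun i ↦ chartFrame φ i x) = b := by
    funext i
    have h3 : b i = L (EuclideanSpace.basisFun (Fin m) ℝ i) := by
      rw [Module.Basis.map_apply, OrthonormalBasis.coe_toBasis]
    exact (h1 i).trans h3.symm
  rw [h2]
  exact (f.map_basis_ne_zero_iff b).2 hf

variable [IsManifold (𝓡 m) ∞ M]

theorem fieldSmoothAt_chartFrame {φ : OpenPartialHomeomorph M (EuclideanSpace ℝ (Fin m))}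
    (hφ : φ ∈ IsManifold.maximalAtlas (𝓡 m) ∞ M) (i : Fin m) {x : M} (hx : x ∈ φ.source) :
    FieldSmoothAt (chartFrame φ i) x := by
  refine ContMDiffAt.mpullback_vectorField_preimage (n := ∞) ?_
    (contMDiffAt_of_mem_maximalAtlas hφ hx)
    ⟨(mdifferentiable_of_mem_maximalAtlas hφ).mfderiv hx, rfl⟩ (by simp)
  exact contMDiffAt_vectorSpace_iff_contDiffAt.2 contDiffAt_const

end ChartFrame

theorem wedgePow_neg_left (n : ℕ) {V : Type*} (η : V → ℝ) (Ω : V → V → ℝ)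
    (v : Fin (2 * n + 1) → V) : wedgePow n (fun u ↦ -η u) Ω v = -wedgePow n η Ω v := by
  simp only [wedgePow, neg_mul, mul_neg, Finset.sum_neg_distrib]

/-! ### The orientation selects a global unit kernel field. -/

section OrientedKernel

variable {n : ℕ} {M : Type*} [TopologicalSpace M]
  [ChartedSpace (EuclideanSpace ℝ (Fin (2 * n + 1))) M] [IsManifold (𝓡 (2 * n + 1)) ∞ M]
  {g : RMetric (2 * n + 1) M}
  {θ : Π x : M, TangentSpace (𝓡 (2 * n + 1)) x →L[ℝ] TangentSpace (𝓡 (2 * n + 1)) x}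

/-- The alternating form `v♭ ∧ p_θ^n` on the tangent space at `x`. -/
noncomputable def RMetric.kernelVolume (g : RMetric (2 * n + 1) M)
    (θ : Π x : M, TangentSpace (𝓡 (2 * n + 1)) x →L[ℝ] TangentSpace (𝓡 (2 * n + 1)) x) (x : M)
    (v : TangentSpace (𝓡 (2 * n + 1)) x) :
    TangentSpace (𝓡 (2 * n + 1)) x [⋀^Fin (2 * n + 1)]→ₗ[ℝ] ℝ :=
  wedgePowAlternating n (g.inner x v).toLinearMap
    (ContinuousLinearMap.coeLM ℝ ∘ₗ (g.form θ x).toLinearMap)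

theorem RMetric.kernelVolume_apply (x : M) (v : TangentSpace (𝓡 (2 * n + 1)) x)
    (w : Fin (2 * n + 1) → TangentSpace (𝓡 (2 * n + 1)) x) :
    g.kernelVolume θ x v w = wedgePow n (fun u ↦ g.inner x v u) (fun u w ↦ g.form θ x u w) w :=
  wedgePowAlternating_apply n _ _ w

theorem RMetric.kernelVolume_neg (x : M) (v : TangentSpace (𝓡 (2 * n + 1)) x)
    (w : Fin (2 * n + 1) → TangentSpace (𝓡 (2 * n + 1)) x) :
    g.kernelVolume θ x (-v) w = -g.kernelVolume θ x v w := by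
  rw [g.kernelVolume_apply, g.kernelVolume_apply, ← wedgePow_neg_left]
  simp

theorem RMetric.kernelVolume_ne_zero {x : M}
    (hskew : ∀ u v, g.inner x (θ x u) v = -g.inner x u (θ x v))
    (hrank : Module.finrank ℝ (LinearMap.range (θ x).toLinearMap) = 2 * n)
    {k : TangentSpace (𝓡 (2 * n + 1)) x} (hk : θ x k = 0) (hk1 : g.inner x k k = 1) :
    g.kernelVolume θ x k ≠ 0 := by
  have : FiniteDimensional ℝ (TangentSpace (𝓡 (2 * n + 1)) x) :=
    inferInstanceAs (FiniteDimensional ℝ (EuclideanSpace ℝ (Fin (2 * n + 1))))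
  refine wedgePowAlternating_ne_zero (ξ := k) finrank_euclideanSpace_fin (fun v ↦ ?_) ?_
    (fun u hu ↦ ⟨_, eq_smul_of_mem_ker hrank hk hk1 (g.ext_inner fun w ↦ ?_)⟩) hk1
  · have h1 : g.inner x (θ x v) v = -g.inner x v (θ x v) := hskew v v
    have h2 : g.inner x (θ x v) v = g.inner x v (θ x v) := g.symm x _ _
    change g.inner x (θ x v) v = 0
    linarith
  · refine LinearMap.ext fun w ↦ ?_
    change g.inner x (θ x k) w = 0
    rw [hk, map_zero]
    rfl
  · rw [map_zero]
    exact hu w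

/-- The expanded wedge product is a polynomial in inner products of fields smooth at `x₀`. -/
theorem RMetric.continuousAt_kernelVolume (hθ : IsSmoothEndo θ)
    {φ : OpenPartialHomeomorph M (EuclideanSpace ℝ (Fin (2 * n + 1)))}
    (hφ : φ ∈ IsManifold.maximalAtlas (𝓡 (2 * n + 1)) ∞ M) {x₀ : M} (hx₀ : x₀ ∈ φ.source)
    {ζ : Π x : M, TangentSpace (𝓡 (2 * n + 1)) x} (hζ : FieldSmoothAt ζ x₀) :
    ContinuousAt (fun x ↦ g.kernelVolume θ x (ζ x) fun i ↦ chartFrame φ i x) x₀ := by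
  simp only [g.kernelVolume_apply, wedgePow]
  have hF := fun i ↦ fieldSmoothAt_chartFrame hφ i hx₀
  have hθF : ∀ i, FieldSmoothAt (fun x ↦ θ x (chartFrame φ i x)) x₀ := fun i ↦
    ContMDiffAt.clm_bundle_apply (b := fun x : M ↦ x)
      (E₁ := fun x : M ↦ TangentSpace (𝓡 (2 * n + 1)) x)
      (E₂ := fun x : M ↦ TangentSpace (𝓡 (2 * n + 1)) x) (hθ x₀) (hF i)
  refine continuousAt_const.mul (tendsto_finsetSum _ fun σ _ ↦ continuousAt_const.mul
    (ContinuousAt.mul ?_ (tendsto_finsetProd _ fun i _ ↦ ?_)))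
  · exact (hζ.inner (g := g) (hF _)).continuousAt
  · exact ((hθF _).inner (g := g) (hF _)).continuousAt

/-- An orientation of `M` and a skew-symmetric endomorphism field of rank `2n` determine a smooth
unit section of the kernel. -/
theorem exists_isUnitKernelField
    {A : Set (OpenPartialHomeomorph M (EuclideanSpace ℝ (Fin (2 * n + 1))))}
    (hA : IsOrientedAtlas A) (hθ : IsSmoothEndo θ)
    (hskew : ∀ x u v, g.inner x (θ x u) v = -g.inner x u (θ x v))
    (hrank : ∀ x, Module.finrank ℝ (LinearMap.range (θ x).toLinearMap) = 2 * n) :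
    ∃ ξ : Π x : M, TangentSpace (𝓡 (2 * n + 1)) x, IsUnitKernelField g θ ξ := by
  -- Of the two unit kernel vectors, the one with positive volume is taken. Positivity is required
  -- in every chart of `A`, so that near `x₀` the choices at different points can be compared in a
  -- single chart.
  have hex : ∀ x, ∃ v, θ x v = 0 ∧ g.inner x v v = 1 ∧ ∀ φ ∈ A, x ∈ φ.source →
      0 < g.kernelVolume θ x v fun i ↦ chartFrame φ i x := by
    intro x
    obtain ⟨φ, hφA, hφ⟩ := hA.covers x
    have hall : ∀ v, 0 < (g.kernelVolume θ x v fun i ↦ chartFrame φ i x) → ∀ ψ ∈ A,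
        x ∈ ψ.source → 0 < g.kernelVolume θ x v fun i ↦ chartFrame ψ i x := by
      intro v hv ψ hψA hψ
      rw [AlternatingMap.chartFrame_eq_det_mul (hA.subset_maximalAtlas hψA)
        (hA.subset_maximalAtlas hφA) hψ hφ]
      exact mul_pos (hA.det_pos ψ hψA φ hφA x ⟨hψ, hφ⟩) hv
    obtain ⟨k, hk, hk1⟩ := exists_unit_mem_ker g (hrank x)
    rcases (AlternatingMap.chartFrame_ne_zero (hA.subset_maximalAtlas hφA) hφ
      (g.kernelVolume_ne_zero (hskew x) (hrank x) hk hk1)).lt_or_gt with h | h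
    · refine ⟨-k, by rw [map_neg, hk, neg_zero], by simpa using hk1, hall _ ?_⟩
      rw [g.kernelVolume_neg]
      exact neg_pos.2 h
    · exact ⟨k, hk, hk1, hall k h⟩
  choose ξ hker hunit hpos using hex
  refine ⟨ξ, fun x₀ ↦ ?_, fun x ↦ ?_, hunit⟩
  swap
  · change g.inner x (θ x (ξ x)) = 0
    rw [hker, map_zero]
  obtain ⟨φ, hφA, hφ⟩ := hA.covers x₀
  have hφm := hA.subset_maximalAtlas hφA
  obtain ⟨ζ, hζ, hζker, hζpos⟩ : ∃ ζ : Π x : M, TangentSpace (𝓡 (2 * n + 1)) x,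
      FieldSmoothAt ζ x₀ ∧ (∀ᶠ x in 𝓝 x₀, θ x (ζ x) = 0 ∧ g.inner x (ζ x) (ζ x) = 1) ∧
        0 < g.kernelVolume θ x₀ (ζ x₀) fun i ↦ chartFrame φ i x₀ := by
    obtain ⟨ζ, hζ, hζker⟩ := exists_local_unit_kernel_field hθ hskew hrank x₀
    rcases (AlternatingMap.chartFrame_ne_zero hφm hφ (g.kernelVolume_ne_zero (hskew x₀) (hrank x₀)
      hζker.self_of_nhds.1 hζker.self_of_nhds.2)).lt_or_gt with h | h
    · refine ⟨-ζ, hζ.neg_section, ?_, ?_⟩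
      · filter_upwards [hζker] with x hx
        exact ⟨by rw [Pi.neg_apply, map_neg, hx.1, neg_zero], by simpa using hx.2⟩
      · rw [Pi.neg_apply, g.kernelVolume_neg]
        exact neg_pos.2 h
    · exact ⟨ζ, hζ, hζker, h⟩
  -- The smooth local section `ζ`, with its sign adjusted at `x₀`, keeps positive volume nearby.
  -- There `ξ = ±ζ`, and the minus sign would make the volume of `ξ` negative, so `ξ` agrees with
  -- `ζ` near `x₀`.
  have hev := (g.continuousAt_kernelVolume hθ hφm hφ hζ).eventually_const_lt hζpos
  refine hζ.congr_of_eventuallyEq ?_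
  filter_upwards [hζker, hev, φ.open_source.mem_nhds hφ] with x hx hx' hxφ
  congr 1
  have h1 := eq_smul_of_mem_ker (hrank x) hx.1 hx.2 (hker x)
  set c := g.inner x (ζ x) (ξ x)
  have h2 := hunit x
  rw [h1] at h2
  have h3 : c * c = 1 := by
    simpa [hx.2] using h2
  rcases mul_self_eq_one_iff.1 h3 with h | h
  · rw [h1, h, one_smul]
  · have h4 := hpos x φ hφA hxφ
    rw [h1, h, neg_one_smul, g.kernelVolume_neg] at h4
    linarith

end OrientedKernel

/-! ### Assembly of the theorem. -/

theorem mainTheorem5 {n : ℕ} {M : Type*} [TopologicalSpace M] [T2Space M]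
    [SecondCountableTopology M] [ChartedSpace (EuclideanSpace ℝ (Fin (2 * n + 1))) M]
    [IsManifold (𝓡 (2 * n + 1)) ∞ M]
    (A : Set (OpenPartialHomeomorph M (EuclideanSpace ℝ (Fin (2 * n + 1)))))
    (hA : IsOrientedAtlas A)
    (g : RMetric (2 * n + 1) M)
    (θ : Π x : M, TangentSpace (𝓡 (2 * n + 1)) x →L[ℝ] TangentSpace (𝓡 (2 * n + 1)) x)
    (hθ_smooth : IsSmoothEndo θ)
    (hθ_skew : ∀ x u v, g.inner x (θ x u) v = -g.inner x u (θ x v))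
    (hθ_rank : ∀ x, Module.finrank ℝ (LinearMap.range (θ x).toLinearMap) = 2 * n)
    (hθ_gauge : IsParallelEndo g.leviCivita θ) :
    (∃ ξ : Π x : M, TangentSpace (𝓡 (2 * n + 1)) x, IsUnitKernelField g θ ξ) ∧
    (∀ ξ : Π x : M, TangentSpace (𝓡 (2 * n + 1)) x, IsUnitKernelField g θ ξ →
      IsCosymplectic (g.form θ) (g.flat ξ) ∧ IsReebField (g.form θ) (g.flat ξ) ξ ∧
        g.IsKilling ξ) ∧
    IsKCosymplectic n M := by
  have h1 := exists_isUnitKernelField (g := g) hA hθ_smooth hθ_skew hθ_rank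
  have h2 : ∀ ξ : Π x : M, TangentSpace (𝓡 (2 * n + 1)) x, IsUnitKernelField g θ ξ →
      IsCosymplectic (g.form θ) (g.flat ξ) ∧ IsReebField (g.form θ) (g.flat ξ) ξ ∧
        g.IsKilling ξ := by
    intro ξ hξ
    have hpar := hξ.leviCivita_eq_zero hθ_rank hθ_gauge
    refine ⟨⟨hθ_smooth.smooth_form g hθ_skew, hξ.smooth.smooth_flat g,
      hθ_gauge.isClosedTwoForm hθ_smooth hθ_skew,
      g.isClosedOneForm_flat_of_parallel hξ.smooth hpar, fun x ↦ ?_⟩,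
      ⟨hξ.smooth, hξ.mem_ker, hξ.unit⟩, g.isKilling_of_parallel hξ.smooth hpar⟩
    obtain ⟨v, hv⟩ : ∃ v, g.kernelVolume θ x (ξ x) v ≠ 0 := by
      by_contra! h
      exact g.kernelVolume_ne_zero (hθ_skew x) (hθ_rank x) (hξ.apply_eq_zero x) (hξ.unit x)
        (AlternatingMap.ext h)
    exact ⟨v, by rwa [g.kernelVolume_apply] at hv⟩
  obtain ⟨ξ, hξ⟩ := h1
  obtain ⟨hc, hr, hk⟩ := h2 ξ hξ
  exact ⟨⟨ξ, hξ⟩, h2, g.form θ, g.flat ξ, hc, ξ, hr, g, hk⟩
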